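/- Theorem 4.1. Let $B_n$ denote the $n$-th Bernoulli number (with $B_1=-1/2$), and for $n\ge 1$ let $j_n$ denote the positive denominator of $-B_{2n}/(2n)=\zeta(1-2n)$ in lowest terms. Let $k$ and $\ell$ be positive even integers with $k\le \ell$ and $m=k+\ell\ge 6$. Then for all nonnegative integers $u$, $v$ with $u+v=k-1$, $$ j_{m/2}\binom{m/2-1}{u}\binom{m/2-1}{v}\left(\frac{B_m}{m}\left(\frac{B_\ell}{\ell}+\frac{B_k}{k}\right)-\frac{B_\ell}{\ell}\,\frac{B_k}{k}\right)+\frac{\delta_{k,2}}{2} $$ is an integer, where $\delta_{k,2}$ is $1$ if $k=2$ and $0$ otherwise. -/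

import Mathlib

/-- `jDenom n` is the positive denominator, in lowest terms, of `-B_{2n} / (2n) = ζ(1 - 2n)`,
for `n ≥ 1`. -/
def jDenom (n : ℕ) : ℕ := (-(bernoulli (2 * n)) / ((2 * n : ℕ) : ℚ)).den

/-! Integrality is checked one prime `p` at a time. Fix an odd `c` generating the units modulo
powers of `p` (up to sign if `p = 2`), and put C_n = c^n - 1 and K_n = C_n B_n / (2n), so that B_n /
n = 2 K_n / C_n. Since C_m = C_k + C_l + C_k C_l, the bilinear expression times `j` collapses to J
(2 K_l (K_m - K_k) / C_l + 2 K_k (K_m - K_l) / C_k - 2 K_l K_k), where J = 2j / C_m.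

Von Staudt-Clausen makes J `p`-integral. Kummer's congruences say that (1 - p^(n-1)) K_n changes by
a multiple of C_l when n grows by l (`kummerTerm_add_sub_div_mem_pIntegers`); they follow from
Voronoi's congruence, which approximates these numbers by sums with weights independent of n. Among
the Euler factor corrections only 2 p^(k-1) / C_l can fail to be integral
(`bernoulli_expression_add_mem_pIntegers`).

The binomial coefficients repair that term (`padicValNat_add_one_le_of_choose`) unless p = k = 2.
There it is half a 2-adic unit, which the summand 1/2 compensates. -/

/-- The subring of rationals whose denominator is prime to `p`. -/
def pIntegers (p : ℕ) [Fact p.Prime] : Subring ℚ := (Rat.padicValuation p).integer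

/-! ### Arithmetic of `p`-integral rationals. -/

section pIntegers

variable {p : ℕ} [hp : Fact p.Prime]

theorem mem_pIntegers_iff {x : ℚ} : x ∈ pIntegers p ↔ ¬ p ∣ x.den :=
  Rat.padicValuation_le_one_iff

theorem inv_natCast_mem_pIntegers {b : ℕ} (hb : ¬ p ∣ b) : (b : ℚ)⁻¹ ∈ pIntegers p := by
  rw [mem_pIntegers_iff]
  rcases Nat.eq_zero_or_pos b with rfl | h0
  · simp at hb
  · rwa [Rat.inv_natCast_den_of_pos h0]

theorem inv_intCast_mem_pIntegers {b : ℤ} (hb : ¬ (p : ℤ) ∣ b) : (b : ℚ)⁻¹ ∈ pIntegers p := by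
  rw [mem_pIntegers_iff, Rat.inv_intCast_den]
  have hb0 : b ≠ 0 := by rintro rfl; simp at hb
  rw [if_neg hb0]
  exact fun h => hb (Int.natCast_dvd.mpr h)

/-- If the power of `p` dividing `b` divides `a`, then `a / b` is `p`-integral. -/
theorem intCast_div_natCast_mem_pIntegers {a : ℤ} {b e : ℕ} (hb : b ≠ 0)
    (hbe : padicValNat p b ≤ e) (ha : (p : ℤ) ^ e ∣ a) : (a : ℚ) / b ∈ pIntegers p := by
  obtain ⟨b', hb'⟩ := pow_padicValNat_dvd (p := p) (n := b)
  obtain ⟨a', ha'⟩ := (pow_dvd_pow (p : ℤ) hbe).trans ha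
  have hp0 : (p : ℚ) ≠ 0 := mod_cast hp.out.ne_zero
  have hpb : ¬ p ∣ b' := by
    rintro ⟨t, rfl⟩
    apply pow_succ_padicValNat_not_dvd (p := p) hb
    exact ⟨t, by rw [pow_succ, mul_assoc, ← hb']⟩
  have : (a : ℚ) / b = a' * (b' : ℚ)⁻¹ := by
    have h1 : (a : ℚ) = (p : ℚ) ^ padicValNat p b * a' := by exact_mod_cast ha'
    have h2 : (b : ℚ) = (p : ℚ) ^ padicValNat p b * b' := by exact_mod_cast hb'
    rw [h1, h2, mul_div_mul_left _ _ (pow_ne_zero _ hp0), div_eq_mul_inv]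
  rw [this]
  exact mul_mem (intCast_mem _ _) (inv_natCast_mem_pIntegers hpb)

theorem natCast_div_natCast_mem_pIntegers {a b : ℕ} (hb : b ≠ 0)
    (h : padicValNat p b ≤ padicValNat p a) : (a : ℚ) / b ∈ pIntegers p := by
  have := intCast_div_natCast_mem_pIntegers (p := p) (a := a) hb h
    (by exact_mod_cast pow_padicValNat_dvd)
  rwa [Int.cast_natCast] at this

theorem inv_one_add_mem_pIntegers {r : ℚ} (hr : r ∈ pIntegers p) :
    (1 + p * r)⁻¹ ∈ pIntegers p := by
  have h1 : Rat.padicValuation p (p * r) < 1 := by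
    rw [map_mul]
    refine mul_lt_one_of_lt_of_le ?_ hr
    rw [Rat.padicValuation_self]
    decide
  have h2 := (Rat.padicValuation p).map_one_add_of_lt h1
  change Rat.padicValuation p _ ≤ 1
  rw [map_inv₀, h2, inv_one]

theorem one_sub_div_two_mem_pIntegers {x : ℚ} (hx0 : x ≠ 0) (hx : x ∈ pIntegers 2)
    (hx' : x⁻¹ ∈ pIntegers 2) : (1 - x) / 2 ∈ pIntegers 2 := by
  rw [mem_pIntegers_iff] at hx hx'
  rw [Rat.den_inv_of_ne_zero hx0] at hx'
  have hev : (2 : ℤ) ∣ x.den - x.num := by omega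
  obtain ⟨t, ht⟩ := hev
  have hd : (x.den : ℚ) ≠ 0 := mod_cast x.den_ne_zero
  have : (1 - x) / 2 = t * (x.den : ℚ)⁻¹ := by
    have h1 : (x.den : ℚ) - x.num = 2 * t := by exact_mod_cast ht
    have h2 : x * x.den = x.num := Rat.mul_den_eq_num x
    field_simp
    linear_combination h1 - h2
  rw [this]
  exact mul_mem (intCast_mem _ _) (inv_natCast_mem_pIntegers hx)

/-- A rational number approximated to arbitrary `p`-adic precision by multiples of `p ^ e`
is `p ^ e` times a `p`-integral number. -/
theorem div_pow_mem_pIntegers_of_approx {x : ℚ} {d : ℕ} (hd : d ≠ 0) {e : ℕ}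
    (h : ∀ N, ∃ a b : ℤ, (p : ℤ) ^ e ∣ a ∧ d * (x - a) = (p : ℚ) ^ N * b) :
    x / (p : ℚ) ^ e ∈ pIntegers p := by
  -- The extra precision absorbs the `p`-part of the fixed denominator `d`.
  obtain ⟨a, b, ⟨a', rfl⟩, hab⟩ := h (e + padicValNat p d)
  have hp0 : (p : ℚ) ≠ 0 := mod_cast hp.out.ne_zero
  have hd0 : (d : ℚ) ≠ 0 := mod_cast hd
  have h1 := intCast_div_natCast_mem_pIntegers (p := p) (a := (p : ℤ) ^ padicValNat p d) hd le_rfl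
    dvd_rfl
  have : x / (p : ℚ) ^ e = a' + ((p ^ padicValNat p d : ℤ) : ℚ) / d * b := by
    push_cast at hab ⊢
    rw [pow_add] at hab
    field_simp
    linear_combination hab
  rw [this]
  exact add_mem (intCast_mem _ _) (mul_mem h1 (intCast_mem _ _))

end pIntegers

theorem exists_intCast_eq_of_forall_mem_pIntegers {x : ℚ}
    (h : ∀ p : ℕ, ∀ [Fact p.Prime], x ∈ pIntegers p) : ∃ z : ℤ, x = z := by
  refine ⟨x.num, (Rat.coe_int_num_of_den_eq_one ?_).symm⟩
  by_contra hx
  obtain ⟨p, hp, hdvd⟩ := Nat.ne_one_iff_exists_prime_dvd.mp hx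
  exact (have : Fact p.Prime := ⟨hp⟩; mem_pIntegers_iff.mp (h p)) hdvd

/-! ### Test bases and the valuation of c^n - 1. -/

/-- An odd integer `c > 1` generating the units modulo every power of `p`, up to sign if `p = 2`. -/
structure IsTestBase (p c : ℕ) : Prop where
  one_lt : 1 < c
  odd : Odd c
  not_dvd : ¬ p ∣ c
  not_dvd_pow_sub_one : ∀ n, ¬ (p - 1) ∣ n → ¬ p ∣ c ^ n - 1
  padicValNat_pow_sub_one : ∀ n, n ≠ 0 → Even n → (p - 1) ∣ n →
    padicValNat p (c ^ n - 1) = padicValNat p (2 * n) + 1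

/-- Lifting the exponent, starting from c^(p-1) - 1, whose valuation is exactly 1. -/
theorem padicValNat_pow_sub_one_of_sub_one_dvd {p c : ℕ} [hp : Fact p.Prime] (hp2 : p ≠ 2)
    (hc1 : 1 < c) (hpc : ¬ p ∣ c) (hc : ¬ p ^ 2 ∣ c ^ (p - 1) - 1) {n : ℕ} (hn : n ≠ 0)
    (hpn : (p - 1) ∣ n) : padicValNat p (c ^ n - 1) = padicValNat p (2 * n) + 1 := by
  have h3 : 3 ≤ p := by have := hp.out.two_le; omega
  have hpodd : Odd p := hp.out.odd_of_ne_two hp2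
  obtain ⟨s, rfl⟩ := hpn
  have hs : s ≠ 0 := by rintro rfl; simp at hn
  have hlt : 1 < c ^ (p - 1) := Nat.one_lt_pow (by omega) hc1
  have hdvd : p ∣ c ^ (p - 1) - 1 := by
    rw [← Nat.modEq_iff_dvd' hlt.le]
    have := Nat.ModEq.pow_totient ((Nat.coprime_comm.mp (hp.out.coprime_iff_not_dvd.mpr hpc)))
    rw [Nat.totient_prime hp.out] at this
    exact this.symm
  have hne : c ^ (p - 1) - 1 ≠ 0 := by omega
  have hv1 : padicValNat p (c ^ (p - 1) - 1) = 1 := by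
    have h1 := one_le_padicValNat_of_dvd hne hdvd
    have h2 : ¬ 2 ≤ padicValNat p (c ^ (p - 1) - 1) := fun h =>
      hc ((padicValNat_dvd_iff_le hne).mpr h)
    omega
  have key := padicValNat.pow_sub_pow (p := p) hpodd hlt (by simpa using hdvd)
    (fun h => hpc (hp.out.dvd_of_dvd_pow h)) hs
  rw [one_pow, ← pow_mul, hv1] at key
  rw [key, padicValNat.mul two_ne_zero hn, padicValNat.mul (by omega) hs,
    padicValNat.eq_zero_of_not_dvd (n := 2) (fun h => by have := Nat.le_of_dvd two_pos h; omega),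
    padicValNat.eq_zero_of_not_dvd (n := p - 1)
      (fun h => by have := Nat.le_of_dvd (by omega) h; omega)]
  omega

theorem isTestBase_two_three : IsTestBase 2 3 where
  one_lt := by norm_num
  odd := by decide
  not_dvd := by norm_num
  not_dvd_pow_sub_one n h := by simp at h
  padicValNat_pow_sub_one n hn he _ := by
    have key := padicValNat.pow_two_sub_one (x := 3) (n := n) (by norm_num) (by norm_num) hn he
    have h4 : padicValNat 2 (3 + 1) = 2 := by
      rw [show 3 + 1 = 2 ^ 2 by norm_num, padicValNat.prime_pow]
    have h2 : padicValNat 2 (3 - 1) = 1 := padicValNat_self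
    rw [h4, h2] at key
    rw [padicValNat.mul two_ne_zero hn, padicValNat_self]
    omega

theorem exists_isTestBase (p : ℕ) [hp : Fact p.Prime] (hp2 : p ≠ 2) : ∃ c, IsTestBase p c := by
  have h3 : 3 ≤ p := by have := hp.out.two_le; omega
  have hpodd : Odd p := hp.out.odd_of_ne_two hp2
  have : NeZero (p ^ 2) := ⟨pow_ne_zero _ hp.out.ne_zero⟩
  have := ZMod.isCyclic_units_of_prime_pow p hp.out hp2 2
  obtain ⟨g, hg⟩ := IsCyclic.exists_ofOrder_eq_natCard (α := (ZMod (p ^ 2))ˣ)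
  rw [Nat.card_eq_fintype_card, ZMod.card_units_eq_totient, Nat.totient_prime_pow_succ hp.out,
    pow_one] at hg
  obtain ⟨c, hc1, hcodd, hcg⟩ : ∃ c : ℕ, 1 < c ∧ Odd c ∧ (c : ZMod (p ^ 2)) = g := by
    have hv : ((g : ZMod (p ^ 2)).val : ZMod (p ^ 2)) = g := ZMod.natCast_zmod_val _
    have hz : ((p ^ 2 : ℕ) : ZMod (p ^ 2)) = 0 := ZMod.natCast_self _
    have hodd : Odd (p ^ 2) := hpodd.pow
    have hlarge : 1 < p ^ 2 := Nat.one_lt_pow two_ne_zero (by omega)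
    -- Adding p^2 or 2p^2 to a representative of the generator makes it odd and larger than 1.
    rcases Nat.even_or_odd (g : ZMod (p ^ 2)).val with he | ho
    · exact ⟨(g : ZMod (p ^ 2)).val + p ^ 2, by omega, he.add_odd hodd, by
        rw [Nat.cast_add, hv, hz, add_zero]⟩
    · exact ⟨(g : ZMod (p ^ 2)).val + 2 * p ^ 2, by omega, ho.add_even (even_two_mul _), by
        rw [Nat.cast_add, hv, Nat.cast_mul, hz, mul_zero, add_zero]⟩
  have hpow : ∀ n, p ^ 2 ∣ c ^ n - 1 ↔ p * (p - 1) ∣ n := by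
    intro n
    rw [← hg, orderOf_dvd_iff_pow_eq_one, ← Nat.modEq_iff_dvd' (Nat.one_le_pow _ _ (by omega)),
      ← ZMod.natCast_eq_natCast_iff, Nat.cast_pow, hcg, Nat.cast_one, eq_comm, Units.ext_iff]
    simp
  have hpc : ¬ p ∣ c := by
    have : IsUnit (c : ZMod (p ^ 2)) := hcg ▸ g.isUnit
    rw [ZMod.isUnit_iff_coprime] at this
    exact hp.out.coprime_iff_not_dvd.mp ((Nat.coprime_pow_right_iff two_pos _ _).mp this).symm
  refine ⟨c, hc1, hcodd, hpc, ?_, ?_⟩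
  · intro n hn hdvd
    apply hn
    -- A `p`-th power lifts the congruence to p^2, where the order p(p-1) of `c` must divide np.
    have h1 : p ^ 2 ∣ c ^ (n * p) - 1 := by
      have h := dvd_sub_pow_of_dvd_sub (R := ℤ) (a := (c : ℤ) ^ n) (b := 1) (p := p) (by
        have := Int.natCast_dvd_natCast.mpr hdvd
        rwa [Nat.cast_sub (Nat.one_le_pow _ _ (by omega)), Nat.cast_pow, Nat.cast_one] at this) 1
      rw [one_pow, pow_one, ← pow_mul] at h
      zify [Nat.one_le_pow (n * p) c (by omega)]
      exact h
    rw [hpow, mul_comm n p] at h1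
    exact Nat.dvd_of_mul_dvd_mul_left hp.out.pos h1
  · intro n hn _ hpn
    refine padicValNat_pow_sub_one_of_sub_one_dvd hp2 hc1 hpc (fun h => ?_) hn hpn
    rw [hpow] at h
    have := Nat.le_of_dvd (by omega) h
    nlinarith [Nat.sub_add_cancel hp.out.one_le]

/-- The `p`-part of `c ^ n - 1` divides `x ^ n - 1` for all `x` prime to `p`. -/
theorem IsTestBase.pow_padicValNat_dvd_pow_sub_one {p c : ℕ} [hp : Fact p.Prime]
    (h : IsTestBase p c) {n : ℕ} (hn : n ≠ 0) (hne : Even n) {x : ℤ} (hx : ¬ (p : ℤ) ∣ x) :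
    (p : ℤ) ^ padicValNat p (c ^ n - 1) ∣ x ^ n - 1 := by
  by_cases hpn : (p - 1) ∣ n
  swap
  · rw [padicValNat.eq_zero_of_not_dvd (h.not_dvd_pow_sub_one n hpn)]
    simp
  rw [h.padicValNat_pow_sub_one n hn hne hpn, padicValNat.mul two_ne_zero hn]
  rcases eq_or_ne p 2 with rfl | hp2
  · obtain ⟨s, hs⟩ := pow_padicValNat_dvd (p := 2) (n := n)
    have h1 : 1 ≤ padicValNat 2 n := one_le_padicValNat_of_dvd hn hne.two_dvd
    have h8 : (2 : ℤ) ^ 3 ∣ x ^ 2 - 1 := Int.eight_dvd_sq_sub_one_of_odd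
      (Int.not_even_iff_odd.mp fun he => hx he.two_dvd)
    -- Odd squares are 1 modulo 8, and each further squaring gains a factor 2.
    have key : ∀ a : ℕ, (2 : ℤ) ^ (a + 3) ∣ (x ^ 2) ^ (2 ^ a) - 1 := by
      intro a
      induction a with
      | zero => simpa using h8
      | succ a ih =>
        have : (x ^ 2) ^ 2 ^ (a + 1) - 1 = ((x ^ 2) ^ 2 ^ a - 1) * ((x ^ 2) ^ 2 ^ a + 1) := by
          rw [pow_succ 2 a, pow_mul]; ring
        rw [this, show a + 1 + 3 = (a + 3) + 1 by ring, pow_succ]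
        refine mul_dvd_mul ih ?_
        have h2 : (2 : ℤ) ∣ (x ^ 2) ^ 2 ^ a - 1 := (dvd_pow_self 2 (by omega)).trans ih
        omega
    have h2 := key (padicValNat 2 n - 1)
    rw [← pow_mul, ← pow_succ', Nat.sub_add_cancel h1] at h2
    have h3 : x ^ 2 ^ padicValNat 2 n - 1 ∣ x ^ n - 1 := by
      conv_rhs => rw [hs, pow_mul]
      exact sub_one_dvd_pow_sub_one _ _
    refine Dvd.dvd.trans ?_ h3
    rw [padicValNat_self]
    rw [show 1 + padicValNat 2 n + 1 = padicValNat 2 n - 1 + 3 by omega]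
    exact_mod_cast h2
  · have h2 : padicValNat p 2 = 0 := padicValNat.eq_zero_of_not_dvd fun h =>
      hp2 ((Nat.prime_dvd_prime_iff_eq hp.out Nat.prime_two).mp h)
    have hcop : (p ^ padicValNat p n).Coprime (p - 1) :=
      ((Nat.coprime_self_sub_right hp.out.one_le).mpr (Nat.coprime_one_right p)).pow_left _
    obtain ⟨s, hs⟩ := hcop.mul_dvd_of_dvd_of_dvd pow_padicValNat_dvd hpn
    have hf : (p : ℤ) ∣ x ^ (p - 1) - 1 := by
      have := Int.ModEq.pow_card_sub_one_eq_one hp.out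
        ((Nat.prime_iff_prime_int.mp hp.out).coprime_iff_not_dvd.mpr hx).symm
      exact this.symm.dvd
    have h1 := dvd_sub_pow_of_dvd_sub (R := ℤ) (b := 1) hf (padicValNat p n)
    rw [one_pow, ← pow_mul] at h1
    have h3 : x ^ ((p - 1) * p ^ padicValNat p n) - 1 ∣ x ^ n - 1 := by
      conv_rhs => rw [hs, mul_comm (p ^ _) (p - 1), pow_mul]
      exact sub_one_dvd_pow_sub_one _ _
    rw [h2, zero_add]
    exact h1.trans h3

/-! ### Power sums over residues prime to `p` and Voronoi's congruence. -/

/-- The residues modulo `M` prime to `p`. -/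
def primeToResidues (p M : ℕ) : Finset ℕ := (Finset.range M).filter fun x => ¬ p ∣ x

/-- In Faulhaber's formula every term but the linear one is divisible by M^2, up to denominators
bounded independently of `M`. -/
theorem exists_sum_range_pow_sub_eq (n : ℕ) :
    ∃ d : ℕ, d ≠ 0 ∧ ∀ M : ℕ, ∃ z : ℤ,
      d * ((∑ x ∈ Finset.range M, (x : ℚ) ^ n) - M * bernoulli n) = (M : ℚ) ^ 2 * z := by
  refine ⟨(n + 1) * ∏ i ∈ Finset.range n, (bernoulli i).den, ?_, fun M => ?_⟩
  · exact mul_ne_zero (by omega) (Finset.prod_ne_zero_iff.mpr fun i _ => Rat.den_ne_zero _)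
  have hint : ∀ i ∈ Finset.range n, ∃ z : ℤ,
      (((n + 1) * ∏ i ∈ Finset.range n, (bernoulli i).den : ℕ) : ℚ) *
        (bernoulli i * ((n + 1).choose i) * (M : ℚ) ^ (n + 1 - i) / (n + 1)) = (M : ℚ) ^ 2 * z := by
    intro i hi
    obtain ⟨t, ht⟩ := Finset.dvd_prod_of_mem (fun i => (bernoulli i).den) hi
    refine ⟨t * (bernoulli i).num * (n + 1).choose i * (M : ℤ) ^ (n - 1 - i), ?_⟩
    have hi' := Finset.mem_range.mp hi
    rw [ht, show n + 1 - i = 2 + (n - 1 - i) by omega, pow_add]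
    have hn : (n + 1 : ℚ) ≠ 0 := by positivity
    push_cast
    field_simp
    have := Rat.mul_den_eq_num (bernoulli i)
    linear_combination (t : ℚ) * ((n + 1).choose i) * (M : ℚ) ^ 2 * (M : ℚ) ^ (n - 1 - i) * this
  choose! f hf using hint
  refine ⟨∑ i ∈ Finset.range n, f i, ?_⟩
  have h1 : (∑ x ∈ Finset.range M, (x : ℚ) ^ n) - M * bernoulli n =
      ∑ i ∈ Finset.range n, bernoulli i * ((n + 1).choose i) * (M : ℚ) ^ (n + 1 - i) / (n + 1) := by
    rw [sum_range_pow, Finset.sum_range_succ, Nat.choose_succ_self_right,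
      show n + 1 - n = 1 by omega]
    have hn : (n + 1 : ℚ) ≠ 0 := by positivity
    push_cast
    field_simp
    ring
  rw [h1, Finset.mul_sum, Finset.sum_congr rfl hf, ← Finset.mul_sum]
  push_cast
  rfl

theorem sum_primeToResidues_add_sum_range {p : ℕ} (hp : 0 < p) (M n : ℕ) :
    ∑ x ∈ primeToResidues p (p * M), (x : ℚ) ^ n + p ^ n * ∑ x ∈ Finset.range M, (x : ℚ) ^ n =
      ∑ x ∈ Finset.range (p * M), (x : ℚ) ^ n := by
  have h : (Finset.range (p * M)).filter (fun x => p ∣ x) =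
      (Finset.range M).image (fun x => p * x) := by
    ext x
    simp only [Finset.mem_filter, Finset.mem_range, Finset.mem_image]
    constructor
    · rintro ⟨hx, y, rfl⟩
      exact ⟨y, Nat.lt_of_mul_lt_mul_left hx, rfl⟩
    · rintro ⟨y, hy, rfl⟩
      exact ⟨Nat.mul_lt_mul_of_pos_left hy hp, dvd_mul_right _ _⟩
  rw [← Finset.sum_filter_not_add_sum_filter (Finset.range (p * M)) (fun x => p ∣ x), h,
    Finset.sum_image (fun a _ b _ hab => Nat.eq_of_mul_eq_mul_left hp hab), Finset.mul_sum]
  simp only [Nat.cast_mul, mul_pow]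
  rfl

theorem exists_sum_primeToResidues_pow_sub_eq {p : ℕ} (hp : 0 < p) {n : ℕ} (hn : 2 ≤ n) :
    ∃ d : ℕ, d ≠ 0 ∧ ∀ M : ℕ, ∃ z : ℤ,
      d * ((∑ x ∈ primeToResidues p (p * M), (x : ℚ) ^ n) -
        (p * M : ℕ) * ((1 - (p : ℚ) ^ (n - 1)) * bernoulli n)) = ((p * M : ℕ) : ℚ) ^ 2 * z := by
  obtain ⟨d, hd, h⟩ := exists_sum_range_pow_sub_eq n
  refine ⟨d, hd, fun M => ?_⟩
  obtain ⟨z, hz⟩ := h (p * M)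
  obtain ⟨z', hz'⟩ := h M
  refine ⟨z - p ^ (n - 2) * z', ?_⟩
  have key := sum_primeToResidues_add_sum_range hp M n
  obtain ⟨r, rfl⟩ : ∃ r, n = r + 2 := ⟨n - 2, by omega⟩
  simp only [Nat.add_sub_cancel, show r + 2 - 1 = r + 1 by omega]
  push_cast at hz hz' ⊢
  linear_combination (d : ℚ) * key + hz - (p : ℚ) ^ (r + 2) * hz'

/-- Multiplication by `c` permutes the residues prime to `p`. -/
theorem sum_primeToResidues_mul_mod {p M c : ℕ} (hM : 0 < M) (hpM : p ∣ M) (hp : p.Prime)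
    (hcM : c.Coprime M) (hpc : ¬ p ∣ c) (f : ℕ → ℤ) :
    ∑ x ∈ primeToResidues p M, f (c * x % M) = ∑ x ∈ primeToResidues p M, f x := by
  have hmaps : ∀ x ∈ primeToResidues p M, c * x % M ∈ primeToResidues p M := by
    intro x hx
    simp only [primeToResidues, Finset.mem_filter, Finset.mem_range] at hx ⊢
    refine ⟨Nat.mod_lt _ hM, fun h => ?_⟩
    rw [Nat.dvd_mod_iff hpM] at h
    exact (hp.dvd_mul.mp h).elim hpc hx.2
  have hinj : Set.InjOn (fun x => c * x % M) (primeToResidues p M) := by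
    intro x hx y hy hxy
    simp only [primeToResidues, Finset.coe_filter, Finset.mem_range, Set.mem_ofPred_eq] at hx hy
    have h : x ≡ y [MOD M] := Nat.ModEq.cancel_left_of_coprime (Nat.coprime_comm.mp hcM) hxy
    exact h.eq_of_lt_of_lt hx.1 hy.1
  have himg : (primeToResidues p M).image (fun x => c * x % M) = primeToResidues p M :=
    Finset.eq_of_subset_of_card_le (Finset.image_subset_iff.mpr hmaps)
      (Finset.card_image_of_injOn hinj).ge
  conv_rhs => rw [← himg, Finset.sum_image hinj]

/-- Voronoi's congruence. -/
theorem exists_voronoi {p M c : ℕ} (hM : 0 < M) (hpM : p ∣ M) (hp : p.Prime)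
    (hcM : c.Coprime M) (hpc : ¬ p ∣ c) (n : ℕ) :
    ∃ z : ℤ, ((c : ℤ) ^ n - 1) * ∑ x ∈ primeToResidues p M, (x : ℤ) ^ n =
      n * M * ∑ x ∈ primeToResidues p M, ((c * x / M : ℕ) : ℤ) * (c * x : ℤ) ^ (n - 1) +
        (M : ℤ) ^ 2 * z := by
  have h : ∀ x : ℕ, ∃ z : ℤ, (c : ℤ) ^ n * (x : ℤ) ^ n - ((c * x % M : ℕ) : ℤ) ^ n =
      n * M * (((c * x / M : ℕ) : ℤ) * (c * x : ℤ) ^ (n - 1)) + (M : ℤ) ^ 2 * z := by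
    intro x
    -- The remainder is cx - M⌊cx/M⌋; its `n`-th power is expanded to first order in `M`.
    obtain ⟨t, ht⟩ := sq_dvd_add_pow_sub_sub (-((M : ℤ) * (c * x / M : ℕ))) (c * x : ℤ) n
    have hdm : ((c * x % M : ℕ) : ℤ) = c * x + -((M : ℤ) * (c * x / M : ℕ)) := by
      have := Nat.mod_add_div (c * x) M
      zify at this ⊢
      linear_combination this
    refine ⟨-(((c * x / M : ℕ) : ℤ) ^ 2 * t), ?_⟩
    rw [hdm]
    linear_combination -ht + mul_pow (c : ℤ) x n
  choose z hz using h
  refine ⟨∑ x ∈ primeToResidues p M, z x, ?_⟩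
  have hperm := sum_primeToResidues_mul_mod hM hpM hp hcM hpc (fun x => (x : ℤ) ^ n)
  rw [sub_mul, one_mul]
  nth_rewrite 2 [← hperm]
  rw [Finset.mul_sum, ← Finset.sum_sub_distrib, Finset.sum_congr rfl (fun x _ => hz x),
    Finset.sum_add_distrib, Finset.mul_sum, Finset.mul_sum]

/-- The residues modulo `M` prime to `p` in the lower half. -/
def halfResidues (p M : ℕ) : Finset ℕ := (primeToResidues p M).filter fun x => 2 * x < M

theorem sum_primeToResidues_eq_sum_halfResidues {p M : ℕ} (hM : 2 < M) (hpM : p ∣ M)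
    (hpM2 : ∀ x, 2 * x = M → p ∣ x) (f : ℕ → ℤ) :
    ∑ x ∈ primeToResidues p M, f x = ∑ x ∈ halfResidues p M, (f x + f (M - x)) := by
  rw [Finset.sum_add_distrib, halfResidues,
    ← Finset.sum_filter_add_sum_filter_not (primeToResidues p M) (fun x => 2 * x < M) f]
  congr 1
  refine Finset.sum_bij' (fun x _ => M - x) (fun x _ => M - x) ?_ ?_ ?_ ?_ ?_
  all_goals
    intro x hx
    simp only [primeToResidues, Finset.mem_filter, Finset.mem_range] at hx ⊢
  · have h1 : 2 * x ≠ M := fun h => hx.1.2 (hpM2 x h)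
    have h2 : x ≠ 0 := by rintro rfl; exact hx.1.2 (dvd_zero p)
    exact ⟨⟨by omega, fun h => hx.1.2 ((Nat.dvd_sub_iff_right hx.1.1.le hpM).mp h)⟩, by omega⟩
  · have h2 : x ≠ 0 := by rintro rfl; exact hx.1.2 (dvd_zero p)
    exact ⟨⟨by omega, fun h => hx.1.2 ((Nat.dvd_sub_iff_right hx.1.1.le hpM).mp h)⟩, by omega⟩
  · omega
  · omega
  · rw [Nat.sub_sub_self hx.1.1.le]

/-- The sum approximating `(c ^ n - 1) * (1 - p ^ (n - 1)) * B_n / (2 * n)` modulo `M`. -/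
def voronoiSum (p c M n : ℕ) : ℤ :=
  ∑ x ∈ halfResidues p M, (((c * x / M : ℕ) : ℤ) - ((c - 1) / 2 : ℕ)) * (c * x : ℤ) ^ (n - 1)

/-- Under x ↦ M - x the quotient ⌊cx/M⌋ becomes c - 1 - ⌊cx/M⌋ and the odd power changes sign modulo
`M`. Pairing thus gains the factor 2 needed at p = 2; oddness of `c` keeps (c-1)/2 integral. -/
theorem exists_sum_eq_two_mul_voronoiSum {p M c n : ℕ} (hM : 2 < M) (hpM : p ∣ M)
    (hpM2 : ∀ x, 2 * x = M → p ∣ x) (hp : p.Prime) (hpc : ¬ p ∣ c)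
    (hc : Odd c) (hn : Even n) (hn0 : n ≠ 0) :
    ∃ z : ℤ, ∑ x ∈ primeToResidues p M, ((c * x / M : ℕ) : ℤ) * (c * x : ℤ) ^ (n - 1) =
      2 * voronoiSum p c M n + M * z := by
  have h : ∀ x ∈ halfResidues p M, ∃ z : ℤ, ((c * x / M : ℕ) : ℤ) * (c * x : ℤ) ^ (n - 1) +
      ((c * (M - x) / M : ℕ) : ℤ) * (c * (M - x : ℕ) : ℤ) ^ (n - 1) =
      2 * ((((c * x / M : ℕ) : ℤ) - ((c - 1) / 2 : ℕ)) * (c * x : ℤ) ^ (n - 1)) + M * z := by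
    intro x hx
    simp only [halfResidues, primeToResidues, Finset.mem_filter, Finset.mem_range] at hx
    have hxM := hx.1.1
    have hodd : Odd (n - 1) := Nat.Even.sub_odd (by omega) hn odd_one
    have hq : ((c * (M - x) / M : ℕ) : ℤ) = c - 1 - ((c * x / M : ℕ) : ℤ) := by
      have hnd : ¬ M ∣ c * x := fun h =>
        (hp.dvd_mul.mp (hpM.trans h)).elim hpc hx.1.2
      have hmod : 0 < c * x % M := Nat.pos_of_ne_zero fun h => hnd (Nat.dvd_of_mod_eq_zero h)
      have hlt := Nat.mod_lt (c * x) (show 0 < M by omega)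
      have hdm := Nat.div_add_mod (c * x) M
      rw [Int.natCast_div, Nat.cast_mul, Nat.cast_sub hxM.le,
        Int.ediv_eq_iff_of_pos (by omega)]
      zify at hdm hlt hmod
      push_cast
      constructor <;> linarith
    have hcast : ((M - x : ℕ) : ℤ) = M - x := Nat.cast_sub hxM.le
    obtain ⟨t, ht⟩ := sub_dvd_pow_sub_pow ((c : ℤ) * (M - x)) (-(c * x)) (n - 1)
    rw [hodd.neg_pow] at ht
    obtain ⟨s, hs⟩ := hc
    have hh : (((c - 1) / 2 : ℕ) : ℤ) * 2 = c - 1 := by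
      rw [hs]; simp; ring
    refine ⟨(c - 1 - ((c * x / M : ℕ) : ℤ)) * c * t, ?_⟩
    rw [hq, hcast]
    linear_combination (c - 1 - ((c * x / M : ℕ) : ℤ)) * ht + (c * x : ℤ) ^ (n - 1) * hh
  choose! z hz using h
  refine ⟨∑ x ∈ halfResidues p M, z x, ?_⟩
  rw [sum_primeToResidues_eq_sum_halfResidues hM hpM hpM2, Finset.sum_congr rfl hz,
    Finset.sum_add_distrib, voronoiSum, Finset.mul_sum, Finset.mul_sum]

/-! ### Kummer's congruences. -/

/-- `(c ^ n - 1) * (1 - p ^ (n - 1)) * B_n / (2 * n)`, the `n`-th moment of a `p`-adic measure. -/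
def kummerTerm (p c n : ℕ) : ℚ :=
  ((c : ℚ) ^ n - 1) * ((1 - (p : ℚ) ^ (n - 1)) * bernoulli n) / (2 * n)

theorem exists_kummerTerm_sub_voronoiSum_eq {p c : ℕ} [hp : Fact p.Prime] (h : IsTestBase p c)
    {n : ℕ} (hn : Even n) (hn0 : n ≠ 0) :
    ∃ d : ℕ, d ≠ 0 ∧ ∀ N, ∃ z : ℤ,
      d * (kummerTerm p c n - voronoiSum p c (p ^ (N + 2)) n) = (p : ℚ) ^ N * z := by
  obtain ⟨d, hd, hS⟩ := exists_sum_primeToResidues_pow_sub_eq hp.out.pos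
    (n := n) (by obtain ⟨r, rfl⟩ := hn; omega)
  refine ⟨2 * n * d, by positivity, fun N => ?_⟩
  have hp2 := hp.out.two_le
  have hM : p ^ (N + 2) = p * p ^ (N + 1) := pow_succ' _ _
  have hMpos : 0 < p ^ (N + 2) := pow_pos hp.out.pos _
  have hpM : p ∣ p ^ (N + 2) := dvd_pow_self p (by omega)
  have hM2 : 2 < p ^ (N + 2) := by
    have h1 : 2 ^ 2 ≤ p ^ (N + 2) :=
      (Nat.pow_le_pow_left hp2 2).trans (Nat.pow_le_pow_right hp.out.pos (by omega))
    omega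
  -- The exponent is at least 2, so for p = 2 the midpoint is even and no residue prime to `p` is
  -- its own reflection.
  have hhalf : ∀ x, 2 * x = p ^ (N + 2) → p ∣ x := by
    intro x hx
    rcases eq_or_ne p 2 with rfl | hne
    · exact ⟨2 ^ N, by rw [pow_succ' 2 (N + 1), pow_succ'] at hx; omega⟩
    · refine (hp.out.dvd_mul.mp (hx ▸ hpM)).resolve_left fun h2 => hne ?_
      exact (Nat.prime_dvd_prime_iff_eq hp.out Nat.prime_two).mp h2
  have hcop : c.Coprime (p ^ (N + 2)) :=
    ((hp.out.coprime_iff_not_dvd.mpr h.not_dvd).symm).pow_right _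
  obtain ⟨z1, h1⟩ := hS (p ^ (N + 1))
  obtain ⟨z2, h2⟩ := exists_voronoi hMpos hpM hp.out hcop h.not_dvd n
  obtain ⟨z3, h3⟩ := exists_sum_eq_two_mul_voronoiSum hM2 hpM hhalf hp.out h.not_dvd h.odd hn hn0
  rw [← hM] at h1
  refine ⟨p ^ 2 * (d * n * z3 + d * z2 - (c ^ n - 1) * z1), ?_⟩
  rw [h3] at h2
  have h2' : ((c : ℚ) ^ n - 1) * ∑ x ∈ primeToResidues p (p ^ (N + 2)), (x : ℚ) ^ n =
      n * (p ^ (N + 2) : ℕ) * (2 * voronoiSum p c (p ^ (N + 2)) n + (p ^ (N + 2) : ℕ) * z3) +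
        ((p ^ (N + 2) : ℕ) : ℚ) ^ 2 * z2 := by exact_mod_cast h2
  have hM0 : ((p ^ (N + 2) : ℕ) : ℚ) ≠ 0 := by exact_mod_cast hMpos.ne'
  have hn0' : (n : ℚ) ≠ 0 := mod_cast hn0
  have hpow : (p : ℚ) ^ N * p ^ 2 = ((p ^ (N + 2) : ℕ) : ℚ) := by push_cast; ring
  have hK : 2 * (n : ℚ) * kummerTerm p c n =
      ((c : ℚ) ^ n - 1) * ((1 - (p : ℚ) ^ (n - 1)) * bernoulli n) := by
    rw [kummerTerm]; field_simp
  push_cast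
  rw [← mul_assoc, hpow]
  apply mul_left_cancel₀ hM0
  generalize ((p ^ (N + 2) : ℕ) : ℚ) = M at *
  linear_combination d * M * hK - ((c : ℚ) ^ n - 1) * h1 + d * h2'

theorem kummerTerm_mem_pIntegers {p c : ℕ} [Fact p.Prime] (h : IsTestBase p c)
    {n : ℕ} (hn : Even n) (hn0 : n ≠ 0) : kummerTerm p c n ∈ pIntegers p := by
  obtain ⟨d, hd, hd'⟩ := exists_kummerTerm_sub_voronoiSum_eq h hn hn0
  have := div_pow_mem_pIntegers_of_approx (p := p) (x := kummerTerm p c n) hd (e := 0) fun N =>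
    let ⟨z, hz⟩ := hd' N
    ⟨_, z, by simp, hz⟩
  simpa using this

/-- The weights do not involve the exponent, and (cx)^l is 1 modulo the `p`-part of c^l - 1. -/
theorem pow_padicValNat_dvd_voronoiSum_sub {p c : ℕ} [Fact p.Prime] (h : IsTestBase p c)
    {k l : ℕ} (hk0 : k ≠ 0) (hl : Even l) (hl0 : l ≠ 0) (M : ℕ) :
    (p : ℤ) ^ padicValNat p (c ^ l - 1) ∣ voronoiSum p c M (k + l) - voronoiSum p c M k := by
  rw [voronoiSum, voronoiSum, ← Finset.sum_sub_distrib]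
  refine Finset.dvd_sum fun x hx => ?_
  simp only [halfResidues, primeToResidues, Finset.mem_filter] at hx
  have hcx : ¬ (p : ℤ) ∣ c * x := by
    rw [← Nat.cast_mul, Int.natCast_dvd_natCast]
    exact fun hd => ((Fact.out : p.Prime).dvd_mul.mp hd).elim h.not_dvd hx.1.2
  obtain ⟨t, ht⟩ := h.pow_padicValNat_dvd_pow_sub_one hl0 hl hcx
  refine ⟨(((c * x / M : ℕ) : ℤ) - ((c - 1) / 2 : ℕ)) * (c * x : ℤ) ^ (k - 1) * t, ?_⟩
  rw [show k + l - 1 = k - 1 + l by omega, pow_add]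
  linear_combination (((c * x / M : ℕ) : ℤ) - ((c - 1) / 2 : ℕ)) * (c * x : ℤ) ^ (k - 1) * ht

/-- **Kummer's congruences**, in a form valid for all primes and all even weights. -/
theorem kummerTerm_add_sub_div_mem_pIntegers {p c : ℕ} [hp : Fact p.Prime] (h : IsTestBase p c)
    {k l : ℕ} (hk : Even k) (hk0 : k ≠ 0) (hl : Even l) (hl0 : l ≠ 0) :
    (kummerTerm p c (k + l) - kummerTerm p c k) / ((c : ℚ) ^ l - 1) ∈ pIntegers p := by
  obtain ⟨d, hd, hd'⟩ := exists_kummerTerm_sub_voronoiSum_eq h hk hk0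
  obtain ⟨d₁, hd₁, hd₁'⟩ := exists_kummerTerm_sub_voronoiSum_eq h (hk.add hl) (n := k + l) (by omega)
  have hone : 1 < c ^ l := Nat.one_lt_pow hl0 h.one_lt
  have h1 := div_pow_mem_pIntegers_of_approx (p := p) (d := d * d₁)
    (x := kummerTerm p c (k + l) - kummerTerm p c k)
    (mul_ne_zero hd hd₁) (e := padicValNat p (c ^ l - 1)) fun N => by
      obtain ⟨z, hz⟩ := hd' N
      obtain ⟨z₁, hz₁⟩ := hd₁' N
      refine ⟨_, d * z₁ - d₁ * z,
        pow_padicValNat_dvd_voronoiSum_sub h (k := k) hk0 hl hl0 (p ^ (N + 2)), ?_⟩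
      push_cast
      linear_combination (d : ℚ) * hz₁ - (d₁ : ℚ) * hz
  have h2 := intCast_div_natCast_mem_pIntegers (p := p) (b := c ^ l - 1)
    (a := (p : ℤ) ^ padicValNat p (c ^ l - 1)) (by omega) le_rfl dvd_rfl
  have h3 := mul_mem h1 h2
  have hp0 : (p : ℚ) ≠ 0 := mod_cast hp.out.ne_zero
  rw [Nat.cast_sub hone.le, Int.cast_pow, Int.cast_natCast, Nat.cast_pow, Nat.cast_one,
    div_mul_div_cancel₀ (pow_ne_zero _ hp0)] at h3
  exact h3

/-! ### Consequences of von Staudt-Clausen for B_n and for the denominator `jDenom`. -/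

theorem exists_mul_bernoulli_eq {p : ℕ} [hp : Fact p.Prime] {n : ℕ} (hn : Even n) (hn0 : n ≠ 0)
    (hpn : (p - 1) ∣ n) : ∃ r ∈ pIntegers p, p * bernoulli n = -(1 + p * r) := by
  obtain ⟨k, rfl⟩ := hn.two_dvd
  obtain ⟨z, hz⟩ := Bernoulli.vonStaudt_clausen k
  have hmem : p ∈ (Finset.range (2 * k + 2)).filter fun q => q.Prime ∧ (q - 1) ∣ 2 * k := by
    simp only [Finset.mem_filter, Finset.mem_range]
    have := Nat.le_of_dvd (Nat.pos_of_ne_zero hn0) hpn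
    exact ⟨by omega, hp.out, hpn⟩
  rw [← Finset.add_sum_erase _ _ hmem] at hz
  refine ⟨(∑ q ∈ ((Finset.range (2 * k + 2)).filter
    fun q => q.Prime ∧ (q - 1) ∣ 2 * k).erase p, (1 : ℚ) / q) - z, ?_, ?_⟩
  · refine sub_mem (sum_mem fun q hq => ?_) (intCast_mem _ _)
    rw [Finset.mem_erase, Finset.mem_filter] at hq
    rw [one_div]
    exact inv_natCast_mem_pIntegers fun hd =>
      hq.1 ((Nat.prime_dvd_prime_iff_eq hp.out hq.2.2.1).mp hd).symm
  · have hp0 : (p : ℚ) ≠ 0 := mod_cast hp.out.ne_zero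
    have : (p : ℚ) * (1 / p) = 1 := by field_simp
    linear_combination -(p : ℚ) * hz - this

theorem mul_bernoulli_mem_pIntegers {p : ℕ} [Fact p.Prime] {n : ℕ} (hn : Even n) (hn0 : n ≠ 0)
    (hpn : (p - 1) ∣ n) : p * bernoulli n ∈ pIntegers p := by
  obtain ⟨r, hr, h⟩ := exists_mul_bernoulli_eq hn hn0 hpn
  rw [h]
  exact neg_mem (add_mem (one_mem _) (mul_mem (natCast_mem _ _) hr))

theorem inv_mul_bernoulli_mem_pIntegers {p : ℕ} [Fact p.Prime] {n : ℕ} (hn : Even n) (hn0 : n ≠ 0)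
    (hpn : (p - 1) ∣ n) : (p * bernoulli n)⁻¹ ∈ pIntegers p := by
  obtain ⟨r, hr, h⟩ := exists_mul_bernoulli_eq hn hn0 hpn
  rw [h, inv_neg]
  exact neg_mem (inv_one_add_mem_pIntegers hr)

theorem bernoulli_ne_zero_of_sub_one_dvd {p : ℕ} [hp : Fact p.Prime] {n : ℕ} (hn : Even n)
    (hn0 : n ≠ 0) (hpn : (p - 1) ∣ n) : bernoulli n ≠ 0 := by
  intro hB
  obtain ⟨r, hr, h⟩ := exists_mul_bernoulli_eq hn hn0 hpn
  have hp0 : (p : ℚ) ≠ 0 := mod_cast hp.out.ne_zero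
  have hr' : r = -(p : ℚ)⁻¹ := by
    rw [hB] at h
    field_simp
    linear_combination h
  rw [hr', mem_pIntegers_iff, Rat.neg_den, Rat.inv_natCast_den_of_pos hp.out.pos] at hr
  exact hr dvd_rfl

theorem jDenom_mul_bernoulli_eq {m : ℕ} (hm : Even m) :
    ((jDenom (m / 2) : ℕ) : ℚ) * (bernoulli m / m) = ((bernoulli m / m).num : ℚ) ∧
      jDenom (m / 2) = (bernoulli m / m).den := by
  have : jDenom (m / 2) = (bernoulli m / m).den := by
    rw [jDenom, Nat.two_mul_div_two_of_even hm, neg_div, Rat.neg_den]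
  exact ⟨by rw [this, Rat.den_mul_eq_num], this⟩

/-- The quotient is the numerator of B_m / m divided by the `p`-adic unit p B_m. -/
theorem jDenom_div_mem_pIntegers {p : ℕ} [hp : Fact p.Prime] {m : ℕ} (hm : Even m) (hm0 : m ≠ 0)
    (hpm : (p - 1) ∣ m) : (jDenom (m / 2) : ℚ) / (p * m) ∈ pIntegers p := by
  have h := mul_mem (intCast_mem (pIntegers p) (bernoulli m / m).num)
    (inv_mul_bernoulli_mem_pIntegers (p := p) hm hm0 hpm)
  have hp0 : (p : ℚ) ≠ 0 := mod_cast hp.out.ne_zero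
  have hm0' : (m : ℚ) ≠ 0 := mod_cast hm0
  have hB := bernoulli_ne_zero_of_sub_one_dvd hm hm0 hpm
  rw [← (jDenom_mul_bernoulli_eq hm).1] at h
  convert h using 1
  field_simp

theorem two_mul_jDenom_div_mem_pIntegers {p c : ℕ} [hp : Fact p.Prime] (h : IsTestBase p c)
    {m : ℕ} (hm : Even m) (hm0 : m ≠ 0) :
    2 * (jDenom (m / 2) : ℚ) / ((c : ℚ) ^ m - 1) ∈ pIntegers p := by
  have hone : 1 < c ^ m := Nat.one_lt_pow hm0 h.one_lt
  have hcast : ((c ^ m - 1 : ℕ) : ℚ) = (c : ℚ) ^ m - 1 := by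
    rw [Nat.cast_sub hone.le]; push_cast; rfl
  by_cases hpm : (p - 1) ∣ m
  · have h1 := jDenom_div_mem_pIntegers hm hm0 hpm
    have h2 := natCast_div_natCast_mem_pIntegers (p := p) (a := 2 * m * p) (b := c ^ m - 1)
      (by omega) (by
        rw [h.padicValNat_pow_sub_one m hm0 hm hpm, padicValNat.mul (by omega) hp.out.ne_zero,
          padicValNat_self])
    have h3 := mul_mem h1 h2
    have hp0 : (p : ℚ) ≠ 0 := mod_cast hp.out.ne_zero
    have hm0' : (m : ℚ) ≠ 0 := mod_cast hm0
    rw [hcast] at h3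
    push_cast at h3
    convert h3 using 1
    field_simp
  · have h1 := inv_natCast_mem_pIntegers (h.not_dvd_pow_sub_one m hpm)
    rw [hcast] at h1
    exact mul_mem (mul_mem (ofNat_mem _ 2) (natCast_mem _ _)) h1

/-- `kummerTerm` without its Euler factor. -/
def fullKummerTerm (c n : ℕ) : ℚ := ((c : ℚ) ^ n - 1) * bernoulli n / (2 * n)

theorem kummerTerm_eq (p c n : ℕ) :
    kummerTerm p c n = (1 - (p : ℚ) ^ (n - 1)) * fullKummerTerm c n := by
  rw [kummerTerm, fullKummerTerm]
  ring

/-- The Euler factor 1 - p^(n-1) is a `p`-adic unit because n ≥ 2. -/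
theorem fullKummerTerm_mem_pIntegers {p c : ℕ} [hp : Fact p.Prime] (h : IsTestBase p c)
    {n : ℕ} (hn : Even n) (hn0 : n ≠ 0) : fullKummerTerm c n ∈ pIntegers p := by
  obtain ⟨r, rfl⟩ : ∃ r, n = r + 2 := ⟨n - 2, by obtain ⟨r, rfl⟩ := hn; omega⟩
  have h1 := inv_one_add_mem_pIntegers (p := p) (r := -(p : ℚ) ^ r)
    (neg_mem (pow_mem (natCast_mem _ _) _))
  have hne : (1 + p * -(p : ℚ) ^ r) ≠ 0 := by
    have : (1 : ℚ) < (p : ℚ) ^ (r + 1) := one_lt_pow₀ (mod_cast hp.out.one_lt) (by omega)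
    rw [pow_succ'] at this
    intro h0
    linarith
  have h2 := mul_mem h1 (kummerTerm_mem_pIntegers h hn hn0)
  rw [kummerTerm_eq, show r + 2 - 1 = r + 1 by omega,
    show 1 - (p : ℚ) ^ (r + 1) = 1 + p * -(p : ℚ) ^ r by ring, inv_mul_cancel_left₀ hne] at h2
  exact h2

theorem padicValNat_pow_sub_one_le {p c : ℕ} [Fact p.Prime] (h : IsTestBase p c)
    {n : ℕ} (hn : Even n) (hn0 : n ≠ 0) :
    padicValNat p (c ^ n - 1) ≤ padicValNat p (2 * n) + 1 := by
  by_cases hpn : (p - 1) ∣ n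
  · exact (h.padicValNat_pow_sub_one n hn0 hn hpn).le
  · rw [padicValNat.eq_zero_of_not_dvd (h.not_dvd_pow_sub_one n hpn)]
    exact Nat.zero_le _

theorem two_mul_div_pow_sub_one_mem_pIntegers {p c : ℕ} [Fact p.Prime] (h : IsTestBase p c)
    {n : ℕ} (hn : Even n) (hn0 : n ≠ 0) {a : ℕ} (ha0 : a ≠ 0)
    (ha : padicValNat p n + 1 ≤ padicValNat p a) :
    2 * (a : ℚ) / ((c : ℚ) ^ n - 1) ∈ pIntegers p := by
  have hone : 1 < c ^ n := Nat.one_lt_pow hn0 h.one_lt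
  have hle := padicValNat_pow_sub_one_le h hn hn0
  rw [padicValNat.mul two_ne_zero hn0] at hle
  have h1 := natCast_div_natCast_mem_pIntegers (p := p) (a := 2 * a) (b := c ^ n - 1)
    (by omega) (by rw [padicValNat.mul two_ne_zero ha0]; omega)
  rw [Nat.cast_sub hone.le] at h1
  push_cast at h1
  exact h1

/-! ### Divisibility of the binomial coefficients. -/

/-- The power of `p` dividing `k * n.choose k` is at most `n`. -/
theorem padicValNat_choose_add_padicValNat_le_log {p n k : ℕ} [hp : Fact p.Prime]
    (hkn : k ≤ n) : padicValNat p (n.choose k) + padicValNat p k ≤ Nat.log p n := by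
  rw [padicValNat_choose hkn (Nat.lt_succ_self _)]
  -- The valuation counts carries, and none occurs where the low base-`p` digits of `k` vanish.
  have hsub : (Finset.Ico 1 (Nat.log p n).succ).filter
      (fun i => p ^ i ≤ k % p ^ i + (n - k) % p ^ i) ⊆
      Finset.Ico (padicValNat p k + 1) (Nat.log p n).succ := by
    intro i hi
    simp only [Finset.mem_filter, Finset.mem_Ico] at hi ⊢
    refine ⟨?_, hi.1.2⟩
    by_contra hlt
    have h1 : k % p ^ i = 0 := Nat.mod_eq_zero_of_dvd
      ((pow_dvd_pow p (by omega)).trans pow_padicValNat_dvd)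
    have h2 := Nat.mod_lt (n - k) (pow_pos hp.out.pos i)
    omega
  have hcard := Finset.card_le_card hsub
  rw [Nat.card_Ico] at hcard
  have hle : padicValNat p k ≤ Nat.log p n :=
    (padicValNat_le_nat_log k).trans (Nat.log_mono_right hkn)
  omega

/-- Trinomial revision produces `(a + t).choose (a + 1) * (a + 1)`, which is `t * (a + t).choose a`.
-/
theorem dvd_choose_mul_choose_mul {a t u : ℕ} (hau : a + 1 ≤ u) :
    t ∣ (a + t).choose u * (u.choose (a + 1) * (a + 1)) := by
  have h1 := Nat.choose_mul (n := a + t) (k := u) (s := a + 1) hau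
  have h2 := Nat.choose_succ_right_eq (a + t) a
  rw [Nat.add_sub_cancel_left] at h2
  refine ⟨(a + t).choose a * (a + t - (a + 1)).choose (u - (a + 1)), ?_⟩
  rw [← mul_assoc, h1, mul_right_comm, h2]
  ring

theorem padicValNat_add_one_le_of_choose {p k l u v : ℕ} [hp : Fact p.Prime] (hk : Even k)
    (hl : Even l) (hk0 : 0 < k) (hkl : k ≤ l) (huv : u + v = k - 1) (hpk : ¬ (p = 2 ∧ k = 2)) :
    padicValNat p l + 1 ≤ padicValNat p
      (p ^ (k - 1) * (((k + l) / 2 - 1).choose u * ((k + l) / 2 - 1).choose v)) := by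
  -- The sum is k - 1, so one of the two indices is at least k/2.
  wlog huk : k / 2 ≤ u generalizing u v
  · have := this (u := v) (v := u) (by omega) (by obtain ⟨r, rfl⟩ := hk; omega)
    rwa [mul_comm (Nat.choose _ v)] at this
  obtain ⟨a, ha⟩ : ∃ a, k = 2 * (a + 1) := ⟨k / 2 - 1, by obtain ⟨r, rfl⟩ := hk; omega⟩
  obtain ⟨t, rfl⟩ := hl.two_dvd
  have hN : (k + 2 * t) / 2 - 1 = a + t := by omega
  rw [hN]
  have hu : u ≤ a + t := by omega
  have hv : v ≤ a + t := by omega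
  have hCu : (a + t).choose u ≠ 0 := (Nat.choose_pos hu).ne'
  have hCv : (a + t).choose v ≠ 0 := (Nat.choose_pos hv).ne'
  have hCa : u.choose (a + 1) ≠ 0 := (Nat.choose_pos (by omega)).ne'
  have hdvd := dvd_choose_mul_choose_mul (a := a) (t := t) (u := u) (by omega)
  have hle : padicValNat p t ≤ padicValNat p ((a + t).choose u) + Nat.log p u := by
    have h1 := (padicValNat_dvd_iff_le (p := p) (by positivity)).mp
      ((pow_padicValNat_dvd (p := p) (n := t)).trans hdvd)
    rw [padicValNat.mul hCu (by positivity), padicValNat.mul hCa (by omega)] at h1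
    have h2 := padicValNat_choose_add_padicValNat_le_log (p := p) (n := u) (k := a + 1)
      (by omega)
    omega
  -- For p = 2 this rests on k - 1 < 2^(k-2), which fails at k = 2: the exceptional case.
  have hlog : padicValNat p 2 + Nat.log p u + 2 ≤ k := by
    rcases eq_or_ne p 2 with rfl | hp2
    · have hk4 : 4 ≤ k := by omega
      have : Nat.log 2 u < k - 2 := by
        apply Nat.log_lt_of_lt_pow (by omega)
        obtain ⟨r, rfl⟩ : ∃ r, k = r + 4 := ⟨k - 4, by omega⟩
        have := Nat.lt_two_pow_self (n := r)
        rw [show r + 4 - 2 = r + 2 by omega, pow_add]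
        omega
      rw [padicValNat_self]
      omega
    · have : Nat.log p u < k - 1 := by
        apply Nat.log_lt_of_lt_pow (by omega)
        have := Nat.lt_pow_self (n := k - 1) hp.out.one_lt
        omega
      rw [padicValNat.eq_zero_of_not_dvd fun h => hp2
        ((Nat.prime_dvd_prime_iff_eq hp.out Nat.prime_two).mp h)]
      omega
  rw [padicValNat.mul two_ne_zero (by omega),
    padicValNat.mul (pow_ne_zero _ hp.out.ne_zero) (mul_ne_zero hCu hCv), padicValNat.prime_pow,
    padicValNat.mul hCu hCv]
  omega

theorem padicValNat_add_two_le {p k l : ℕ} [hp : Fact p.Prime] (hk0 : 0 < k) (hkl : k ≤ l)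
    (hl : 3 ≤ l) : padicValNat p k + 2 ≤ l := by
  have h1 := padicValNat_le_nat_log (p := p) k
  have h2 : Nat.log p k < l - 1 := by
    apply Nat.log_lt_of_lt_pow (by omega)
    obtain ⟨r, rfl⟩ : ∃ r, l = r + 3 := ⟨l - 3, by omega⟩
    have h3 := Nat.lt_two_pow_self (n := r)
    have h4 : 2 ^ (r + 3 - 1) ≤ p ^ (r + 3 - 1) := Nat.pow_le_pow_left hp.out.two_le _
    have h5 : 2 ^ (r + 3 - 1) = 2 ^ r * 4 := by
      rw [show r + 3 - 1 = r + 2 by omega, pow_add]; rfl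
    omega
  omega

/-! ### Assembly of the local statements. -/

/-- The bilinear Bernoulli expression is `p`-integral up to the contribution of the Euler factor of
smallest weight. -/
theorem bernoulli_expression_add_mem_pIntegers {p c : ℕ} [hp : Fact p.Prime] (h : IsTestBase p c)
    {k l : ℕ} (hk : Even k) (hl : Even l) (hk0 : 0 < k) (hkl : k ≤ l) (hkl6 : 6 ≤ k + l) (b : ℕ) :
    (jDenom ((k + l) / 2) : ℚ) * b *
        (bernoulli (k + l) / ((k + l : ℕ) : ℚ) * (bernoulli l / l + bernoulli k / k)
          - bernoulli l / l * (bernoulli k / k)) +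
      2 * jDenom ((k + l) / 2) / ((c : ℚ) ^ (k + l) - 1) * fullKummerTerm c l * fullKummerTerm c k *
        (2 * (p ^ (k - 1) * b : ℕ) / ((c : ℚ) ^ l - 1)) ∈ pIntegers p := by
  have hm : Even (k + l) := hk.add hl
  have hC : ∀ n : ℕ, n ≠ 0 → (c : ℚ) ^ n - 1 ≠ 0 := fun n hn =>
    (sub_pos.mpr (one_lt_pow₀ (mod_cast h.one_lt) hn)).ne'
  have hJ := two_mul_jDenom_div_mem_pIntegers h hm (by omega)
  have hKl := fullKummerTerm_mem_pIntegers h hl (by omega)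
  have hKk := fullKummerTerm_mem_pIntegers h hk (by omega)
  have hKm := fullKummerTerm_mem_pIntegers h hm (by omega)
  have hD1 := kummerTerm_add_sub_div_mem_pIntegers h hk (by omega) hl (by omega)
  have hD2 := kummerTerm_add_sub_div_mem_pIntegers h hl (by omega) hk (by omega)
  have hE1 := two_mul_div_pow_sub_one_mem_pIntegers h hl (by omega) (a := p ^ (k + l - 1))
    (pow_ne_zero _ hp.out.ne_zero) (by
      rw [padicValNat.prime_pow]
      have := padicValNat_add_two_le (p := p) (k := l) (l := l) (by omega) le_rfl (by omega)
      omega)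
  have hE2 := two_mul_div_pow_sub_one_mem_pIntegers h hk (by omega) (a := p ^ (k + l - 1))
    (pow_ne_zero _ hp.out.ne_zero) (by
      rw [padicValNat.prime_pow]
      have := padicValNat_add_two_le (p := p) (k := k) (l := l) hk0 hkl (by omega)
      omega)
  have hE3 := two_mul_div_pow_sub_one_mem_pIntegers h hk (by omega) (a := p ^ (l - 1))
    (pow_ne_zero _ hp.out.ne_zero) (by
      rw [padicValNat.prime_pow]
      have := padicValNat_add_two_le (p := p) (k := k) (l := l) hk0 hkl (by omega)
      omega)
  have hb := natCast_mem (pIntegers p) b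
  have h2 := ofNat_mem (pIntegers p) 2
  -- The collapsed expression, with each difference of K's replaced by a Kummer quotient plus Euler
  -- corrections; the p^(k-1) correction is left out.
  have hfull := mul_mem (mul_mem hb hJ) (sub_mem (add_mem
    (mul_mem hKl (add_mem (mul_mem h2 hD1) (mul_mem hE1 hKm)))
    (mul_mem hKk (sub_mem (add_mem (mul_mem h2 hD2) (mul_mem hE2 hKm)) (mul_mem hE3 hKl))))
    (mul_mem h2 (mul_mem hKl hKk)))
  convert hfull using 1
  rw [add_comm l k, kummerTerm_eq, kummerTerm_eq, kummerTerm_eq]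
  have hB : ∀ n : ℕ, n ≠ 0 →
      bernoulli n / (n : ℚ) = 2 * fullKummerTerm c n / ((c : ℚ) ^ n - 1) := by
    intro n hn
    have := hC n hn
    have hn' : (n : ℚ) ≠ 0 := mod_cast hn
    rw [fullKummerTerm]
    field_simp
  rw [hB _ (by omega : k + l ≠ 0), hB l (by omega), hB k (by omega)]
  have hCk := hC k (by omega)
  have hCl := hC l (by omega)
  have hCm := hC (k + l) (by omega)
  have hadd : (c : ℚ) ^ (k + l) - 1 =
      ((c : ℚ) ^ k - 1) + ((c : ℚ) ^ l - 1) + ((c : ℚ) ^ k - 1) * ((c : ℚ) ^ l - 1) := by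
    rw [pow_add]; ring
  generalize (c : ℚ) ^ (k + l) - 1 = Cm at *
  generalize (c : ℚ) ^ k - 1 = Ck at *
  generalize (c : ℚ) ^ l - 1 = Cl at *
  generalize fullKummerTerm c k = Kk
  generalize fullKummerTerm c l = Kl
  generalize fullKummerTerm c (k + l) = Km
  push_cast
  subst hadd
  field_simp
  ring

theorem bernoulli_expression_mem_pIntegers {p : ℕ} [hp : Fact p.Prime] {k l u v : ℕ}
    (hk : Even k) (hl : Even l) (hk0 : 0 < k) (hkl : k ≤ l) (hkl6 : 6 ≤ k + l)
    (huv : u + v = k - 1) (hpk : ¬ (p = 2 ∧ k = 2)) :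
    (jDenom ((k + l) / 2) : ℚ) *
        ((((k + l) / 2 - 1).choose u * ((k + l) / 2 - 1).choose v : ℕ) : ℚ) *
        (bernoulli (k + l) / ((k + l : ℕ) : ℚ) * (bernoulli l / l + bernoulli k / k)
          - bernoulli l / l * (bernoulli k / k)) ∈ pIntegers p := by
  obtain ⟨c, h⟩ : ∃ c, IsTestBase p c := by
    rcases eq_or_ne p 2 with rfl | hp2
    · exact ⟨3, isTestBase_two_three⟩
    · exact exists_isTestBase p hp2
  have h1 := bernoulli_expression_add_mem_pIntegers h hk hl hk0 hkl hkl6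
    (((k + l) / 2 - 1).choose u * ((k + l) / 2 - 1).choose v)
  have h2 := two_mul_div_pow_sub_one_mem_pIntegers h hl (by omega)
    (mul_ne_zero (pow_ne_zero (k - 1) hp.out.ne_zero)
      (mul_ne_zero (Nat.choose_pos (by omega)).ne' (Nat.choose_pos (by omega)).ne'))
    (padicValNat_add_one_le_of_choose hk hl hk0 hkl huv hpk)
  have h3 := mul_mem (mul_mem (mul_mem
    (two_mul_jDenom_div_mem_pIntegers h (hk.add hl) (by omega))
    (fullKummerTerm_mem_pIntegers h hl (by omega)))
    (fullKummerTerm_mem_pIntegers h hk (by omega))) h2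
  exact (add_mem_cancel_right h3).mp h1

/-- An even numerator would make B_m / m, hence B_m, 2-integral, although 2 B_m is a 2-adic unit. -/
theorem inv_num_bernoulli_div_mem_pIntegers {m : ℕ} (hm : Even m) (hm0 : m ≠ 0) :
    ((bernoulli m / m).num : ℚ)⁻¹ ∈ pIntegers 2 := by
  apply inv_intCast_mem_pIntegers
  intro hnum
  have hm0' : (m : ℚ) ≠ 0 := mod_cast hm0
  have hden : ¬ 2 ∣ (bernoulli m / m).den := fun hden => by
    have := Nat.dvd_gcd (Int.natCast_dvd.mp hnum) hden
    rw [(bernoulli m / m).reduced] at this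
    omega
  have h1 := mul_mem (mul_mem (mem_pIntegers_iff.mpr hden) (natCast_mem _ m))
    (inv_mul_bernoulli_mem_pIntegers (p := 2) hm hm0 (one_dvd _))
  have hB := bernoulli_ne_zero_of_sub_one_dvd (p := 2) hm hm0 (one_dvd _)
  have h2 : bernoulli m / m * m * ((2 : ℕ) * bernoulli m)⁻¹ = ((2 : ℕ) : ℚ)⁻¹ := by
    field_simp
  rw [h2, mem_pIntegers_iff, Rat.inv_natCast_den_of_pos two_pos] at h1
  exact h1 dvd_rfl

theorem inv_two_mul_jDenom_div_mem_pIntegers {m : ℕ} (hm : Even m) (hm0 : m ≠ 0) :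
    (2 * (jDenom (m / 2) : ℚ) / (((3 : ℕ) : ℚ) ^ m - 1))⁻¹ ∈ pIntegers 2 := by
  have hone : 1 < 3 ^ m := Nat.one_lt_pow hm0 (by norm_num)
  have h1 := natCast_div_natCast_mem_pIntegers (p := 2) (a := 3 ^ m - 1) (b := 2 * m * 2)
    (by omega) (by
      rw [isTestBase_two_three.padicValNat_pow_sub_one m hm0 hm (one_dvd _),
        padicValNat.mul (by omega) two_ne_zero, padicValNat_self])
  have h2 := mul_mem (mul_mem h1 (mul_bernoulli_mem_pIntegers (p := 2) hm hm0 (one_dvd _)))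
    (inv_num_bernoulli_div_mem_pIntegers hm hm0)
  have hm0' : (m : ℚ) ≠ 0 := mod_cast hm0
  have hB := bernoulli_ne_zero_of_sub_one_dvd (p := 2) hm hm0 (one_dvd _)
  have hj : (jDenom (m / 2) : ℚ) ≠ 0 := by
    rw [(jDenom_mul_bernoulli_eq hm).2]
    exact mod_cast Rat.den_ne_zero _
  rw [← (jDenom_mul_bernoulli_eq hm).1, Nat.cast_sub hone.le] at h2
  convert h2 using 1
  push_cast
  field_simp

/-- For `k = 2`, the Euler factor at `2` contributes half a `2`-adic unit. -/
theorem bernoulli_expression_two_mem_pIntegers {l : ℕ} (hl : Even l) (hl4 : 4 ≤ l) :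
    (jDenom ((2 + l) / 2) : ℚ) * ((l / 2 : ℕ) : ℚ) *
        (bernoulli (2 + l) / ((2 + l : ℕ) : ℚ) * (bernoulli l / l + bernoulli 2 / (2 : ℕ))
          - bernoulli l / l * (bernoulli 2 / (2 : ℕ))) + 1 / 2 ∈ pIntegers 2 := by
  have hm : Even (2 + l) := even_two.add hl
  have h1 := bernoulli_expression_add_mem_pIntegers isTestBase_two_three even_two hl
    two_pos (by omega) (by omega) (l / 2)
  have hJ := two_mul_jDenom_div_mem_pIntegers isTestBase_two_three hm (by omega)
  have hJ' := inv_two_mul_jDenom_div_mem_pIntegers hm (by omega)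
  have hB := mul_bernoulli_mem_pIntegers (p := 2) hl (by omega) (one_dvd _)
  have hB' := inv_mul_bernoulli_mem_pIntegers (p := 2) hl (by omega) (one_dvd _)
  have hB0 := bernoulli_ne_zero_of_sub_one_dvd (p := 2) hl (by omega) (one_dvd _)
  have h3 : (((3 : ℕ) : ℚ))⁻¹ ∈ pIntegers 2 := inv_natCast_mem_pIntegers (by norm_num)
  have hC : ∀ n : ℕ, n ≠ 0 → ((3 : ℕ) : ℚ) ^ n - 1 ≠ 0 := fun n hn =>
    (sub_pos.mpr (one_lt_pow₀ (by norm_num) hn)).ne'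
  have hj : (jDenom ((2 + l) / 2) : ℚ) ≠ 0 := by
    rw [(jDenom_mul_bernoulli_eq hm).2]
    exact mod_cast Rat.den_ne_zero _
  set J := 2 * (jDenom ((2 + l) / 2) : ℚ) / (((3 : ℕ) : ℚ) ^ (2 + l) - 1) with hJdef
  have hJ0 : J ≠ 0 := div_ne_zero (mul_ne_zero two_ne_zero hj) (hC _ (by omega))
  -- Since K_2 = 1/3 for c = 3, the leftover term is J B_l / 3, half of this unit.
  have hx := one_sub_div_two_mem_pIntegers (x := J * ((2 : ℕ) * bernoulli l) * ((3 : ℕ) : ℚ)⁻¹)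
    (by positivity) (mul_mem (mul_mem hJ hB) h3) (by
      rw [mul_inv, mul_inv, inv_inv]
      exact mul_mem (mul_mem hJ' hB') (natCast_mem _ 3))
  have hsum := add_mem h1 hx
  convert hsum using 1
  obtain ⟨t, rfl⟩ := hl.two_dvd
  have ht : (t : ℚ) ≠ 0 := by
    have : t ≠ 0 := by omega
    exact mod_cast this
  have hCl := hC (2 * t) (by omega)
  have hK2 : fullKummerTerm 3 2 = 1 / 3 := by
    rw [fullKummerTerm, bernoulli_two]
    norm_num
  have hKl : fullKummerTerm 3 (2 * t) / (((3 : ℕ) : ℚ) ^ (2 * t) - 1) =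
      bernoulli (2 * t) / (4 * t) := by
    rw [fullKummerTerm]
    push_cast at hCl ⊢
    field_simp
    ring
  have hrest : J * fullKummerTerm 3 (2 * t) * fullKummerTerm 3 2 *
      (2 * ((2 ^ (2 - 1) * (2 * t / 2) : ℕ) : ℚ) / (((3 : ℕ) : ℚ) ^ (2 * t) - 1)) =
      J * bernoulli (2 * t) / 3 := by
    rw [hK2, Nat.mul_div_cancel_left t two_pos]
    push_cast at hKl ⊢
    have : J * fullKummerTerm 3 (2 * t) * (1 / 3) * (2 * (2 * t) / (3 ^ (2 * t) - 1)) =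
      J * (1 / 3) * (4 * t) * (fullKummerTerm 3 (2 * t) / (3 ^ (2 * t) - 1)) := by
      ring
    rw [this, hKl]
    field_simp
  rw [hrest]
  push_cast
  ring

theorem theorem4p1 (k l m : ℕ) (hk : Even k) (hl : Even l) (hk0 : 0 < k) (hl0 : 0 < l)
    (hkl : k ≤ l) (hm : m = k + l) (hm6 : 6 ≤ m) (u v : ℕ) (huv : u + v = k - 1) :
    ∃ z : ℤ,
      (jDenom (m / 2) : ℚ) * ((m / 2 - 1).choose u : ℚ) * ((m / 2 - 1).choose v : ℚ) *
          (bernoulli m / (m : ℚ) * (bernoulli l / (l : ℚ) + bernoulli k / (k : ℚ))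
            - bernoulli l / (l : ℚ) * (bernoulli k / (k : ℚ)))
        + (if k = 2 then (1 : ℚ) else 0) / 2 = (z : ℚ) := by
  subst hm
  apply exists_intCast_eq_of_forall_mem_pIntegers
  intro p hp
  rw [mul_assoc (jDenom _ : ℚ), ← Nat.cast_mul]
  by_cases hpk : p = 2 ∧ k = 2
  · obtain ⟨rfl, rfl⟩ := hpk
    have hb : ((2 + l) / 2 - 1).choose u * ((2 + l) / 2 - 1).choose v = l / 2 := by
      rw [show (2 + l) / 2 - 1 = l / 2 by omega]
      rcases (show u = 0 ∧ v = 1 ∨ u = 1 ∧ v = 0 by omega) with ⟨rfl, rfl⟩ | ⟨rfl, rfl⟩ <;> simp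
    rw [hb, if_pos rfl]
    exact bernoulli_expression_two_mem_pIntegers hl (by omega)
  · refine add_mem (bernoulli_expression_mem_pIntegers hk hl hk0 hkl hm6 huv hpk) ?_
    split_ifs with hk2
    · rw [one_div]
      have hp2 : p ≠ 2 := fun h => hpk ⟨h, hk2⟩
      exact_mod_cast inv_natCast_mem_pIntegers (p := p) (b := 2) fun h => hp2
        ((Nat.prime_dvd_prime_iff_eq hp.out Nat.prime_two).mp h)
    · rw [zero_div]
      exact zero_mem _
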